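/- Let $N_5$ be the pentagon, i.e. the five-element lattice $\{x_1,\dots,x_5\}$ with least element $x_5$, greatest element $x_1$, and $x_5<x_4<x_3<x_1$, $x_5<x_2<x_1$, where $x_2$ is incomparable to $x_3$ and $x_4$. A variety of lattices is the class of all lattices satisfying some set of lattice identities; let $\mathcal{N}$ be the variety generated by $N_5$, i.e. the smallest variety of lattices containing $N_5$. For elements $a,b$ of a lattice $L$, $b$ covers $a$ in $L$ (and $a$ is covered by $b$ in $L$) if $a<b$ and there is no $c\in L$ with $a<c<b$. **Theorem 4.1.** Let $L\in\mathcal{N}$ be a lattice that is isomorphic to a sublattice of a free lattice, and let $Y\subseteq L$ be an antichain (a possibly infinite set of pairwise incomparable elements). 1. If there is an element $d\in L$ such that $a\wedge b=d$ for all distinct $a,b\in Y$, then $|Y|\le 3$ and at most two elements of $Y$ do not cover $d$ in $L$. 2. If there is an element $d\in L$ such that $a\vee b=d$ for all distinct $a,b\in Y$, then $|Y|\le 3$ and at most two elements of $Y$ are not covered by $d$ in $L$. -/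

import Mathlib

/-- Lattice terms in variables from `S`. -/
inductive LatticeTerm (S : Type*) where
  | var : S → LatticeTerm S
  | sup : LatticeTerm S → LatticeTerm S → LatticeTerm S
  | inf : LatticeTerm S → LatticeTerm S → LatticeTerm S

namespace LatticeTerm

/-- The value of a lattice term in a lattice `M` under an assignment `f` of its variables. -/
def eval {S M : Type*} [Lattice M] (f : S → M) : LatticeTerm S → M
  | var s => f s
  | sup s t => eval f s ⊔ eval f t
  | inf s t => eval f s ⊓ eval f t

/-- The inequalities between lattice terms that follow from the lattice axioms: the least preorder
on terms for which `sup` is a least upper bound and `inf` is a greatest lower bound. -/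
inductive Le {S : Type*} : LatticeTerm S → LatticeTerm S → Prop where
  | refl (t : LatticeTerm S) : Le t t
  | trans {r s t : LatticeTerm S} : Le r s → Le s t → Le r t
  | le_sup_left (s t : LatticeTerm S) : Le s (sup s t)
  | le_sup_right (s t : LatticeTerm S) : Le t (sup s t)
  | sup_le {r s t : LatticeTerm S} : Le r t → Le s t → Le (sup r s) t
  | inf_le_left (s t : LatticeTerm S) : Le (inf s t) s
  | inf_le_right (s t : LatticeTerm S) : Le (inf s t) t
  | le_inf {r s t : LatticeTerm S} : Le r s → Le r t → Le r (inf s t)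

/-- Two terms are identified when each is below the other. -/
instance setoid (S : Type*) : Setoid (LatticeTerm S) where
  r s t := Le s t ∧ Le t s
  iseqv :=
    { refl := fun t => ⟨.refl t, .refl t⟩
      symm := fun h => ⟨h.2, h.1⟩
      trans := fun h k => ⟨.trans h.1 k.1, .trans k.2 h.2⟩ }

theorem Le.eval_le {S M : Type*} [Lattice M] (f : S → M) {s t : LatticeTerm S} (h : Le s t) :
    eval f s ≤ eval f t := by
  induction h with
  | refl t => exact le_rfl
  | trans _ _ h k => exact h.trans k
  | le_sup_left s t => exact _root_.le_sup_left
  | le_sup_right s t => exact _root_.le_sup_right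
  | sup_le _ _ h k => exact _root_.sup_le h k
  | inf_le_left s t => exact _root_.inf_le_left
  | inf_le_right s t => exact _root_.inf_le_right
  | le_inf _ _ h k => exact _root_.le_inf h k

end LatticeTerm

/-- The free lattice on `S`: lattice terms modulo the consequences of the lattice axioms. -/
def FreeLattice (S : Type*) : Type _ := Quotient (LatticeTerm.setoid S)

namespace FreeLattice

/-- The element of the free lattice represented by a term. -/
def mk {S : Type*} (t : LatticeTerm S) : FreeLattice S := Quotient.mk _ t

/-- The free generator corresponding to `s`. -/
def of {S : Type*} (s : S) : FreeLattice S := mk (.var s)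

instance {S : Type*} : Lattice (FreeLattice S) where
  le := Quotient.lift₂ LatticeTerm.Le fun _ _ _ _ h k =>
    propext ⟨fun l => (h.2.trans l).trans k.1, fun l => (h.1.trans l).trans k.2⟩
  le_refl x := Quotient.inductionOn x fun t => .refl t
  le_trans x y z := Quotient.inductionOn₃ x y z fun _ _ _ h k => LatticeTerm.Le.trans h k
  le_antisymm x y := Quotient.inductionOn₂ x y fun _ _ h k => Quotient.sound ⟨h, k⟩
  sup := Quotient.map₂ LatticeTerm.sup fun _ _ h _ _ k =>
    ⟨.sup_le (h.1.trans (.le_sup_left _ _)) (k.1.trans (.le_sup_right _ _)),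
      .sup_le (h.2.trans (.le_sup_left _ _)) (k.2.trans (.le_sup_right _ _))⟩
  inf := Quotient.map₂ LatticeTerm.inf fun _ _ h _ _ k =>
    ⟨.le_inf ((LatticeTerm.Le.inf_le_left _ _).trans h.1)
        ((LatticeTerm.Le.inf_le_right _ _).trans k.1),
      .le_inf ((LatticeTerm.Le.inf_le_left _ _).trans h.2)
        ((LatticeTerm.Le.inf_le_right _ _).trans k.2)⟩
  le_sup_left x y := Quotient.inductionOn₂ x y fun s t => LatticeTerm.Le.le_sup_left s t
  le_sup_right x y := Quotient.inductionOn₂ x y fun s t => LatticeTerm.Le.le_sup_right s t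
  sup_le x y z := Quotient.inductionOn₃ x y z fun _ _ _ h k => LatticeTerm.Le.sup_le h k
  inf_le_left x y := Quotient.inductionOn₂ x y fun s t => LatticeTerm.Le.inf_le_left s t
  inf_le_right x y := Quotient.inductionOn₂ x y fun s t => LatticeTerm.Le.inf_le_right s t
  le_inf x y z := Quotient.inductionOn₃ x y z fun _ _ _ h k => LatticeTerm.Le.le_inf h k

theorem mk_sup {S : Type*} (s t : LatticeTerm S) : mk (.sup s t) = mk s ⊔ mk t := rfl

theorem mk_inf {S : Type*} (s t : LatticeTerm S) : mk (.inf s t) = mk s ⊓ mk t := rfl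

/-- The lattice homomorphism out of the free lattice that extends `f`. -/
def lift {S M : Type*} [Lattice M] (f : S → M) : LatticeHom (FreeLattice S) M where
  toFun := Quotient.lift (LatticeTerm.eval f) fun _ _ h =>
    le_antisymm (h.1.eval_le f) (h.2.eval_le f)
  map_sup' x y := Quotient.inductionOn₂ x y fun _ _ => rfl
  map_inf' x y := Quotient.inductionOn₂ x y fun _ _ => rfl

/-- The universal property of the free lattice, for target lattices in every universe. -/
theorem existsUnique_lift {S M : Type*} [Lattice M] (f : S → M) :
    ∃! g : LatticeHom (FreeLattice S) M, ∀ s, g (of s) = f s := by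
  refine ⟨lift f, fun s => rfl, fun g hg => ?_⟩
  ext x
  obtain ⟨t, rfl⟩ : ∃ t, mk t = x := Quotient.exists_rep x
  induction t with
  | var s => exact hg s
  | sup s t hs ht => rw [mk_sup, map_sup, map_sup, hs, ht]
  | inf s t hs ht => rw [mk_inf, map_inf, map_inf, hs, ht]

end FreeLattice

/-- A lattice identity `s ≈ t`, in countably many variables. -/
abbrev LatticeIdentity : Type := LatticeTerm ℕ × LatticeTerm ℕ

/-- The lattice `M` belongs to the variety of lattices defined by the set `E` of identities. -/
def InLatticeVariety (E : Set LatticeIdentity) (M : Type*) [Lattice M] : Prop :=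
  ∀ e ∈ E, ∀ f : ℕ → M, LatticeTerm.eval f e.1 = LatticeTerm.eval f e.2

/-- The lattice `L` belongs to the variety generated by the lattice `M`, that is, to every variety
of lattices that contains `M`. -/
def InVarietyGeneratedBy (M : Type*) [Lattice M] (L : Type*) [Lattice L] : Prop :=
  ∀ E : Set LatticeIdentity, InLatticeVariety E M → InLatticeVariety E L

/-- The five elements of the pentagon: top `x1`, bottom `x5`, an element `x2` on one side and a
chain `x4 < x3` on the other. -/
inductive N5 where
  | x1 | x2 | x3 | x4 | x5
  deriving DecidableEq

namespace N5

instance : Fintype N5 where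
  elems := {x1, x2, x3, x4, x5}
  complete x := by cases x <;> decide

/-- The join of the pentagon. -/
def join : N5 → N5 → N5
  | x5, y => y
  | x, x5 => x
  | x2, x2 => x2
  | x4, x4 => x4
  | x3, x3 => x3
  | x3, x4 => x3
  | x4, x3 => x3
  | _, _ => x1

/-- The meet of the pentagon. -/
def meet : N5 → N5 → N5
  | x1, y => y
  | x, x1 => x
  | x2, x2 => x2
  | x3, x3 => x3
  | x4, x4 => x4
  | x3, x4 => x4
  | x4, x3 => x4
  | _, _ => x5

instance : Lattice N5 where
  le x y := join x y = y
  sup := join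
  inf := meet
  le_refl := by decide
  le_trans := by decide
  le_antisymm := by decide
  le_sup_left := by decide
  le_sup_right := by decide
  sup_le := by decide
  inf_le_left := by decide
  inf_le_right := by decide
  le_inf := by decide

end N5

/-! Free lattices satisfy Whitman's condition (W), which passes to sublattices, so `L` satisfies it;
`L` also satisfies every inequality valid in the pentagon. For elements with common pairwise meet d,
two such inequalities give a ⊓ (b ⊔ c) = d and (a ⊔ b) ⊓ (a ⊔ c) = a. Given four elements a, b, c,
e, the triple a ⊔ b, c, e again has pairwise meet d, so (a ⊔ b ⊔ c) ⊓ (a ⊔ b ⊔ e) = a ⊔ b, which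
violates (W) (`not_four`). If p, q, r lie strictly between d and a, b, c respectively, a third
inequality and (W) give a ≤ p ⊔ q and a ≤ p ⊔ r (`left_le_sup`), whence a ≤ (p ⊔ q) ⊓ (p ⊔ r) = p, a
contradiction (`not_three`). The pentagon and (W) are self-dual, which yields the statement on
joins. -/

/-! ### Whitman's condition -/

namespace LatticeTerm

/-- The cut-free presentation of the inequalities between lattice terms. -/
inductive CutFreeLe {S : Type*} : LatticeTerm S → LatticeTerm S → Prop where
  | var (x : S) : CutFreeLe (var x) (var x)
  | sup_le {r s t : LatticeTerm S} : CutFreeLe r t → CutFreeLe s t → CutFreeLe (sup r s) t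
  | le_inf {r s t : LatticeTerm S} : CutFreeLe r s → CutFreeLe r t → CutFreeLe r (inf s t)
  | inf_left {r t : LatticeTerm S} (s : LatticeTerm S) : CutFreeLe r t → CutFreeLe (inf r s) t
  | inf_right {s t : LatticeTerm S} (r : LatticeTerm S) : CutFreeLe s t → CutFreeLe (inf r s) t
  | sup_left {r s : LatticeTerm S} (t : LatticeTerm S) : CutFreeLe r s → CutFreeLe r (sup s t)
  | sup_right {r t : LatticeTerm S} (s : LatticeTerm S) : CutFreeLe r t → CutFreeLe r (sup s t)

namespace CutFreeLe

variable {S : Type*}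

theorem refl (t : LatticeTerm S) : CutFreeLe t t := by
  induction t with
  | var x => exact .var x
  | sup s t hs ht => exact .sup_le (.sup_left t hs) (.sup_right s ht)
  | inf s t hs ht => exact .le_inf (.inf_left t hs) (.inf_right s ht)

/-- The rule `sup_le` is invertible: any other rule that can end such a derivation only decomposes
`t`, so it commutes with the splitting. -/
theorem of_sup_le {r s t : LatticeTerm S} (h : CutFreeLe (sup r s) t) :
    CutFreeLe r t ∧ CutFreeLe s t := by
  generalize hu : sup r s = u at h
  induction h with
  | var => cases hu
  | sup_le h k => cases hu; exact ⟨h, k⟩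
  | le_inf _ _ ih jh => exact ⟨.le_inf (ih hu).1 (jh hu).1, .le_inf (ih hu).2 (jh hu).2⟩
  | inf_left => cases hu
  | inf_right => cases hu
  | sup_left v _ ih => exact ⟨.sup_left v (ih hu).1, .sup_left v (ih hu).2⟩
  | sup_right v _ ih => exact ⟨.sup_right v (ih hu).1, .sup_right v (ih hu).2⟩

theorem of_le_inf {r s t : LatticeTerm S} (h : CutFreeLe r (inf s t)) :
    CutFreeLe r s ∧ CutFreeLe r t := by
  generalize hu : inf s t = u at h
  induction h with
  | var => cases hu
  | sup_le _ _ ih jh => exact ⟨.sup_le (ih hu).1 (jh hu).1, .sup_le (ih hu).2 (jh hu).2⟩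
  | le_inf h k => cases hu; exact ⟨h, k⟩
  | inf_left v _ ih => exact ⟨.inf_left v (ih hu).1, .inf_left v (ih hu).2⟩
  | inf_right v _ ih => exact ⟨.inf_right v (ih hu).1, .inf_right v (ih hu).2⟩
  | sup_left => cases hu
  | sup_right => cases hu

/-- Cut elimination. -/
theorem trans {r s t : LatticeTerm S} (h : CutFreeLe r s) (k : CutFreeLe s t) :
    CutFreeLe r t := by
  -- The outer induction is on the middle term. Inner inductions on the left derivation (variable,
  -- join) or the right one (meet) descend to the rule that introduced it.
  induction s generalizing r t with
  | var x =>
    generalize hu : LatticeTerm.var x = u at h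
    induction h with
    | var => exact hu ▸ k
    | sup_le _ _ ih jh => exact .sup_le (ih hu) (jh hu)
    | le_inf => cases hu
    | inf_left v _ ih => exact .inf_left v (ih hu)
    | inf_right v _ ih => exact .inf_right v (ih hu)
    | sup_left => cases hu
    | sup_right => cases hu
  | sup p q hp hq =>
    obtain ⟨k₁, k₂⟩ := k.of_sup_le
    clear k
    generalize hu : LatticeTerm.sup p q = u at h
    induction h with
    | var => cases hu
    | sup_le _ _ ih jh => exact .sup_le (ih hu) (jh hu)
    | le_inf => cases hu
    | inf_left v _ ih => exact .inf_left v (ih hu)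
    | inf_right v _ ih => exact .inf_right v (ih hu)
    | sup_left v h => cases hu; exact hp h k₁
    | sup_right v h => cases hu; exact hq h k₂
  | inf p q hp hq =>
    obtain ⟨h₁, h₂⟩ := h.of_le_inf
    clear h
    generalize hu : LatticeTerm.inf p q = u at k
    induction k with
    | var => cases hu
    | sup_le => cases hu
    | le_inf _ _ ih jh => exact .le_inf (ih hu) (jh hu)
    | inf_left v k => cases hu; exact hp h₁ k
    | inf_right v k => cases hu; exact hq h₂ k
    | sup_left v _ ih => exact .sup_left v (ih hu)
    | sup_right v _ ih => exact .sup_right v (ih hu)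

end CutFreeLe

theorem le_iff_cutFreeLe {S : Type*} {s t : LatticeTerm S} : Le s t ↔ CutFreeLe s t := by
  constructor <;> intro h
  · induction h with
    | refl t => exact .refl t
    | trans _ _ h k => exact h.trans k
    | le_sup_left s t => exact .sup_left t (.refl s)
    | le_sup_right s t => exact .sup_right s (.refl t)
    | sup_le _ _ h k => exact .sup_le h k
    | inf_le_left s t => exact .inf_left t (.refl s)
    | inf_le_right s t => exact .inf_right s (.refl t)
    | le_inf _ _ h k => exact .le_inf h k
  · induction h with
    | var x => exact .refl _
    | sup_le _ _ h k => exact .sup_le h k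
    | le_inf _ _ h k => exact .le_inf h k
    | inf_left v _ h => exact .trans (.inf_le_left _ _) h
    | inf_right v _ h => exact .trans (.inf_le_right _ _) h
    | sup_left v _ h => exact .trans h (.le_sup_left _ _)
    | sup_right v _ h => exact .trans h (.le_sup_right _ _)

end LatticeTerm

/-- Whitman's condition (W). -/
def WhitmanCondition (L : Type*) [Lattice L] : Prop :=
  ∀ a b c d : L, a ⊓ b ≤ c ⊔ d → a ≤ c ⊔ d ∨ b ≤ c ⊔ d ∨ a ⊓ b ≤ c ∨ a ⊓ b ≤ d

/-- Exactly four rules can end a cut-free derivation of a meet below a join, and they are the four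
alternatives of (W). -/
theorem FreeLattice.whitmanCondition (S : Type*) : WhitmanCondition (FreeLattice S) := by
  intro a b c d
  induction a, b using Quotient.inductionOn₂ with | _ p q
  induction c, d using Quotient.inductionOn₂ with | _ r s
  intro h
  have h' : LatticeTerm.Le (.inf p q) (.sup r s) := h
  rw [LatticeTerm.le_iff_cutFreeLe] at h'
  cases h' with
  | inf_left _ h => exact .inl (LatticeTerm.le_iff_cutFreeLe.2 h)
  | inf_right _ h => exact .inr (.inl (LatticeTerm.le_iff_cutFreeLe.2 h))
  | sup_left _ h => exact .inr (.inr (.inl (LatticeTerm.le_iff_cutFreeLe.2 h)))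
  | sup_right _ h => exact .inr (.inr (.inr (LatticeTerm.le_iff_cutFreeLe.2 h)))

theorem WhitmanCondition.of_latticeHom {L M : Type*} [Lattice L] [Lattice M]
    (hM : WhitmanCondition M) (f : LatticeHom L M) (hf : Function.Injective f) :
    WhitmanCondition L := by
  have le_iff (x y : L) : f x ≤ f y ↔ x ≤ y := by
    rw [← inf_eq_left, ← map_inf, hf.eq_iff, inf_eq_left]
  intro a b c d h
  simpa only [← map_inf, ← map_sup, le_iff] using
    hM (f a) (f b) (f c) (f d) (by simpa only [← map_inf, ← map_sup, le_iff] using h)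

theorem WhitmanCondition.dual {L : Type*} [Lattice L] (h : WhitmanCondition L) :
    WhitmanCondition Lᵒᵈ := by
  intro a b c d hle
  have := h (OrderDual.ofDual c) (OrderDual.ofDual d) (OrderDual.ofDual a) (OrderDual.ofDual b) hle
  tauto

/-! ### Inequalities valid in the variety generated by the pentagon -/

instance : DecidableLE N5 := fun x y => inferInstanceAs (Decidable (N5.join x y = y))

instance {S : Type*} : Max (LatticeTerm S) := ⟨.sup⟩

instance {S : Type*} : Min (LatticeTerm S) := ⟨.inf⟩

/-- The inequality is encoded as the single identity `s ⊔ t ≈ t`. -/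
theorem InVarietyGeneratedBy.eval_le {M L : Type*} [Lattice M] [Lattice L]
    (h : InVarietyGeneratedBy M L) {s t : LatticeTerm ℕ}
    (hst : ∀ f : ℕ → M, s.eval f ≤ t.eval f) (f : ℕ → L) : s.eval f ≤ t.eval f := by
  refine sup_eq_right.1 (h {(s ⊔ t, t)} ?_ (s ⊔ t, t) rfl f)
  rintro e rfl g
  exact sup_eq_right.2 (hst g)

/-- Inequalities of the pentagon that control pairwise meets. -/
structure PentagonInequalities (L : Type*) [Lattice L] : Prop where
  inf_sup_le (x y z : L) : x ⊓ (y ⊔ z) ≤ x ⊓ (y ⊔ x ⊓ z) ⊔ x ⊓ (z ⊔ x ⊓ y)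
  sup_inf_sup_le (a b c : L) :
    (a ⊔ b) ⊓ (a ⊔ c) ≤ a ⊔ (b ⊓ (a ⊔ c) ⊔ c ⊓ (a ⊔ b))
  inf_sup_inf_sup_le (a b c p q : L) :
    ((p ⊓ a ⊔ q ⊓ b ⊔ c) ⊓ (p ⊓ a ⊔ b)) ⊓ (a ⊔ q ⊓ b) ≤
      (p ⊓ a ⊔ q ⊓ b) ⊔ (a ⊓ (b ⊔ c) ⊔ b ⊓ (a ⊔ c))

/-- The assignment of five elements to the first five variables. -/
def assign {M : Type*} (a b c p q : M) : ℕ → M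
  | 0 => a
  | 1 => b
  | 2 => c
  | 3 => p
  | _ => q

theorem N5.inf_sup_le : ∀ x y z : N5, x ⊓ (y ⊔ z) ≤ x ⊓ (y ⊔ x ⊓ z) ⊔ x ⊓ (z ⊔ x ⊓ y) := by
  decide +kernel

theorem N5.le_sup_inf : ∀ x y z : N5, (x ⊔ y ⊓ (x ⊔ z)) ⊓ (x ⊔ z ⊓ (x ⊔ y)) ≤ x ⊔ y ⊓ z := by
  decide +kernel

theorem N5.sup_inf_sup_le : ∀ a b c : N5,
    (a ⊔ b) ⊓ (a ⊔ c) ≤ a ⊔ (b ⊓ (a ⊔ c) ⊔ c ⊓ (a ⊔ b)) := by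
  decide +kernel

theorem N5.le_inf_sup_inf : ∀ a b c : N5,
    a ⊓ ((b ⊔ a ⊓ c) ⊓ (c ⊔ a ⊓ b)) ≤ a ⊓ b ⊔ a ⊓ c := by
  decide +kernel

theorem N5.inf_sup_inf_sup_le : ∀ a b c p q : N5,
    ((p ⊓ a ⊔ q ⊓ b ⊔ c) ⊓ (p ⊓ a ⊔ b)) ⊓ (a ⊔ q ⊓ b) ≤
      (p ⊓ a ⊔ q ⊓ b) ⊔ (a ⊓ (b ⊔ c) ⊔ b ⊓ (a ⊔ c)) := by
  decide +kernel

theorem N5.le_sup_inf_sup_inf : ∀ a b c p q : N5,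
    ((p ⊔ a) ⊓ (q ⊔ b)) ⊓ ((a ⊔ b ⊓ c) ⊓ (b ⊔ a ⊓ c)) ≤
      (((p ⊔ a) ⊓ (q ⊔ b) ⊓ c) ⊔ ((p ⊔ a) ⊓ b)) ⊔ (a ⊓ (q ⊔ b)) := by
  decide +kernel

namespace InVarietyGeneratedBy

open LatticeTerm

variable {L : Type*} [Lattice L]

theorem pentagonInequalities (h : InVarietyGeneratedBy N5 L) : PentagonInequalities L where
  inf_sup_le x y z :=
    h.eval_le (s := var 0 ⊓ (var 1 ⊔ var 2))
      (t := var 0 ⊓ (var 1 ⊔ var 0 ⊓ var 2) ⊔ var 0 ⊓ (var 2 ⊔ var 0 ⊓ var 1))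
      (fun f => N5.inf_sup_le (f 0) (f 1) (f 2)) (assign x y z x x)
  sup_inf_sup_le a b c :=
    h.eval_le (s := (var 0 ⊔ var 1) ⊓ (var 0 ⊔ var 2))
      (t := var 0 ⊔ (var 1 ⊓ (var 0 ⊔ var 2) ⊔ var 2 ⊓ (var 0 ⊔ var 1)))
      (fun f => N5.sup_inf_sup_le (f 0) (f 1) (f 2)) (assign a b c a a)
  inf_sup_inf_sup_le a b c p q :=
    h.eval_le
      (s := ((var 3 ⊓ var 0 ⊔ var 4 ⊓ var 1 ⊔ var 2) ⊓ (var 3 ⊓ var 0 ⊔ var 1)) ⊓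
        (var 0 ⊔ var 4 ⊓ var 1))
      (t := (var 3 ⊓ var 0 ⊔ var 4 ⊓ var 1) ⊔
        (var 0 ⊓ (var 1 ⊔ var 2) ⊔ var 1 ⊓ (var 0 ⊔ var 2)))
      (fun f => N5.inf_sup_inf_sup_le (f 0) (f 1) (f 2) (f 3) (f 4)) (assign a b c p q)

theorem pentagonInequalities_dual (h : InVarietyGeneratedBy N5 L) :
    PentagonInequalities Lᵒᵈ where
  inf_sup_le x y z :=
    h.eval_le (s := (var 0 ⊔ var 1 ⊓ (var 0 ⊔ var 2)) ⊓ (var 0 ⊔ var 2 ⊓ (var 0 ⊔ var 1)))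
      (t := var 0 ⊔ var 1 ⊓ var 2)
      -- Inequalities in `Lᵒᵈ` unfold to inequalities in `L` with joins and meets exchanged, so the
      -- assignment takes values in `L`. The last two values are padding.
      (fun f => N5.le_sup_inf (f 0) (f 1) (f 2)) (assign (M := L) x y z x x)
  sup_inf_sup_le a b c :=
    h.eval_le (s := var 0 ⊓ ((var 1 ⊔ var 0 ⊓ var 2) ⊓ (var 2 ⊔ var 0 ⊓ var 1)))
      (t := var 0 ⊓ var 1 ⊔ var 0 ⊓ var 2)
      (fun f => N5.le_inf_sup_inf (f 0) (f 1) (f 2)) (assign (M := L) a b c a a)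
  inf_sup_inf_sup_le a b c p q :=
    h.eval_le
      (s := ((var 3 ⊔ var 0) ⊓ (var 4 ⊔ var 1)) ⊓
        ((var 0 ⊔ var 1 ⊓ var 2) ⊓ (var 1 ⊔ var 0 ⊓ var 2)))
      (t := (((var 3 ⊔ var 0) ⊓ (var 4 ⊔ var 1) ⊓ var 2) ⊔ ((var 3 ⊔ var 0) ⊓ var 1)) ⊔
        (var 0 ⊓ (var 4 ⊔ var 1)))
      (fun f => N5.le_sup_inf_sup_inf (f 0) (f 1) (f 2) (f 3) (f 4)) (assign (M := L) a b c p q)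

end InVarietyGeneratedBy

/-! ### Elements with a common pairwise meet -/

namespace PentagonInequalities

variable {L : Type*} [Lattice L] {a b c d e p q r : L}

theorem inf_sup_eq (hP : PentagonInequalities L) (hab : a ⊓ b = d) (hac : a ⊓ c = d) :
    a ⊓ (b ⊔ c) = d := by
  have hdb : d ≤ b := hab ▸ inf_le_right
  have hdc : d ≤ c := hac ▸ inf_le_right
  have h := hP.inf_sup_le a b c
  rw [hab, hac, sup_eq_left.2 hdb, sup_eq_left.2 hdc, hab, hac, sup_idem] at h
  exact h.antisymm (le_inf (hab ▸ inf_le_left) (hdb.trans le_sup_left))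

theorem sup_inf_sup_eq (hP : PentagonInequalities L) (hab : a ⊓ b = d) (hac : a ⊓ c = d)
    (hbc : b ⊓ c = d) : (a ⊔ b) ⊓ (a ⊔ c) = a := by
  have h := hP.sup_inf_sup_le a b c
  have hba : b ⊓ (a ⊔ c) = d := hP.inf_sup_eq (inf_comm a b ▸ hab) hbc
  have hca : c ⊓ (a ⊔ b) = d := hP.inf_sup_eq (inf_comm a c ▸ hac) (inf_comm b c ▸ hbc)
  have hda : d ≤ a := hab ▸ inf_le_left
  rw [hba, hca, sup_idem, sup_eq_left.2 hda] at h
  exact h.antisymm (le_inf le_sup_left le_sup_left)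

/-- Four pairwise incomparable elements cannot have a common pairwise meet. -/
theorem not_four (hP : PentagonInequalities L) (hW : WhitmanCondition L)
    (hab : a ⊓ b = d) (hac : a ⊓ c = d) (hae : a ⊓ e = d) (hbc : b ⊓ c = d) (hbe : b ⊓ e = d)
    (hce : c ⊓ e = d) (ha : d < a) (hb : d < b) (hc : d < c) (he : d < e) : False := by
  have hsc : (a ⊔ b) ⊓ c = d := by
    rw [inf_comm] at hac hbc ⊢
    exact hP.inf_sup_eq hac hbc
  have hse : (a ⊔ b) ⊓ e = d := by
    rw [inf_comm] at hae hbe ⊢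
    exact hP.inf_sup_eq hae hbe
  -- The triple is a ⊔ b, c, e.
  have h := hP.sup_inf_sup_eq hsc hse hce
  rcases hW _ _ _ _ h.le with h' | h' | h' | h'
  · exact hc.not_ge (hsc ▸ le_inf (le_sup_right.trans h') le_rfl)
  · exact he.not_ge (hse ▸ le_inf (le_sup_right.trans h') le_rfl)
  · exact hb.not_ge (hab ▸ le_inf (le_sup_right.trans (h ▸ h')) le_rfl)
  · exact ha.not_ge (hab ▸ le_inf le_rfl (le_sup_left.trans (h ▸ h')))

/-- Here (W) applies to (b ⊔ a) ⊓ (b ⊔ c) = b ≤ p ⊔ q; all alternatives but b ⊔ a ≤ p ⊔ q contradict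
the meets or q < b. -/
theorem left_le_of_right_le (hP : PentagonInequalities L) (hW : WhitmanCondition L)
    (hab : a ⊓ b = d) (hac : a ⊓ c = d) (hbc : b ⊓ c = d) (hc : d < c)
    (hq : d < q) (hpa : p ≤ a) (hqb : q < b) (h : b ≤ p ⊔ q) : a ≤ p ⊔ q := by
  have hb := hP.sup_inf_sup_eq (inf_comm a b ▸ hab) hbc hac
  rcases hW (b ⊔ a) (b ⊔ c) p q (hb.le.trans h) with h' | h' | h' | h'
  · exact le_sup_right.trans h'
  · have := hP.inf_sup_eq (inf_comm a c ▸ hac) (inf_comm b c ▸ hbc)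
    exact absurd (this ▸ le_inf le_rfl
      (le_sup_right.trans (h'.trans (sup_le_sup hpa hqb.le)))) hc.not_ge
  · exact absurd (hab ▸ le_inf ((hqb.le.trans (hb ▸ h')).trans hpa) hqb.le) hq.not_ge
  · exact absurd (hb ▸ h') hqb.not_ge

/-- Two uses of (W) on (p ⊔ q ⊔ c) ⊓ (p ⊔ b) ⊓ (a ⊔ q) ≤ p ⊔ q leave a ≤ p ⊔ q or b ≤ p ⊔ q, and the
latter implies the former. -/
theorem left_le_sup (hP : PentagonInequalities L) (hW : WhitmanCondition L)
    (hab : a ⊓ b = d) (hac : a ⊓ c = d) (hbc : b ⊓ c = d) (hc : d < c)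
    (hp : d < p) (hq : d < q) (hpa : p < a) (hqb : q < b) : a ≤ p ⊔ q := by
  have hle := hP.inf_sup_inf_sup_le a b c p q
  -- The meets p ⊓ a and q ⊓ b in the inequality encode the hypotheses p ≤ a and q ≤ b; the last two
  -- terms on the right collapse to d.
  rw [inf_eq_left.2 hpa.le, inf_eq_left.2 hqb.le, hP.inf_sup_eq hab hac,
    hP.inf_sup_eq (inf_comm a b ▸ hab) hbc, sup_idem,
    sup_eq_left.2 (hp.le.trans le_sup_left)] at hle
  have hpq : p ⊔ q ≤ ((p ⊔ q ⊔ c) ⊓ (p ⊔ b)) ⊓ (a ⊔ q) :=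
    le_inf (le_inf le_sup_left (sup_le_sup_left hqb.le p)) (sup_le_sup_right hpa.le q)
  have not_le_left : ¬ p ⊔ q ≤ p := fun h =>
    hq.not_ge (hab ▸ le_inf ((le_sup_right.trans h).trans hpa.le) hqb.le)
  have not_le_right : ¬ p ⊔ q ≤ q := fun h =>
    hp.not_ge (hab ▸ le_inf hpa.le ((le_sup_left.trans h).trans hqb.le))
  rcases hW _ _ _ _ hle with h | h | h | h
  · rcases hW _ _ _ _ h with h' | h' | h' | h'
    · have := hP.inf_sup_eq (inf_comm a c ▸ hac) (inf_comm b c ▸ hbc)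
      exact absurd (this ▸ le_inf le_rfl
        (le_sup_right.trans (h'.trans (sup_le_sup hpa.le hqb.le)))) hc.not_ge
    · exact hP.left_le_of_right_le hW hab hac hbc hc hq hpa.le hqb (le_sup_right.trans h')
    · exact absurd ((hpq.trans inf_le_left).trans h') not_le_left
    · exact absurd ((hpq.trans inf_le_left).trans h') not_le_right
  · exact le_sup_left.trans h
  · exact absurd (hpq.trans h) not_le_left
  · exact absurd (hpq.trans h) not_le_right

/-- Of three elements with a common pairwise meet `d`, at least one covers `d`. -/
theorem not_three (hP : PentagonInequalities L) (hW : WhitmanCondition L)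
    (hab : a ⊓ b = d) (hac : a ⊓ c = d) (hbc : b ⊓ c = d)
    (hp : d < p) (hq : d < q) (hr : d < r) (hpa : p < a) (hqb : q < b) (hrc : r < c) : False := by
  have h₁ := hP.left_le_sup hW hab hac hbc (hr.trans hrc) hp hq hpa hqb
  have h₂ := hP.left_le_sup hW hac hab (inf_comm b c ▸ hbc) (hq.trans hqb) hp hr hpa hrc
  have inf_eq {x y x' y' : L} (h : x ⊓ y = d) (hx : d ≤ x') (hy : d ≤ y') (hx' : x' ≤ x)
      (hy' : y' ≤ y) : x' ⊓ y' = d :=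
    (h ▸ inf_le_inf hx' hy').antisymm (le_inf hx hy)
  -- The smaller elements p, q, r inherit the pairwise meet d.
  have h := hP.sup_inf_sup_eq (inf_eq hab hp.le hq.le hpa.le hqb.le)
    (inf_eq hac hp.le hr.le hpa.le hrc.le) (inf_eq hbc hq.le hr.le hqb.le hrc.le)
  exact hpa.not_ge (h ▸ le_inf h₁ h₂)

theorem encard_le (hP : PentagonInequalities L) (hW : WhitmanCondition L) {Y : Set L}
    (hY : IsAntichain (· ≤ ·) Y) (hd : ∀ a ∈ Y, ∀ b ∈ Y, a ≠ b → a ⊓ b = d) :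
    Y.encard ≤ 3 ∧ {a ∈ Y | ¬ d ⋖ a}.encard ≤ 2 := by
  -- Equality a = d would put a below b, against the antichain condition.
  have lt {a b : L} (ha : a ∈ Y) (hb : b ∈ Y) (hab : a ≠ b) : d < a := by
    refine lt_of_le_of_ne (hd a ha b hb hab ▸ inf_le_left) fun h => hY ha hb hab ?_
    exact inf_eq_left.1 ((hd a ha b hb hab).trans h)
  constructor
  · by_contra! h
    obtain ⟨Z, hZY, hZ⟩ := Set.exists_subset_encard_eq (Order.add_one_le_of_lt h)
    obtain ⟨a, b, c, e, hab, hac, hae, hbc, hbe, hce, rfl⟩ :=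
      Set.encard_eq_four.1 (hZ.trans (by norm_num))
    simp only [Set.insert_subset_iff, Set.singleton_subset_iff] at hZY
    obtain ⟨ha, hb, hc, he⟩ := hZY
    exact hP.not_four hW (hd a ha b hb hab) (hd a ha c hc hac) (hd a ha e he hae)
      (hd b hb c hc hbc) (hd b hb e he hbe) (hd c hc e he hce) (lt ha hb hab)
      (lt hb ha hab.symm) (lt hc ha hac.symm) (lt he ha hae.symm)
  · by_contra! h
    obtain ⟨Z, hZY, hZ⟩ := Set.exists_subset_encard_eq (Order.add_one_le_of_lt h)
    obtain ⟨a, b, c, hab, hac, hbc, rfl⟩ := Set.encard_eq_three.1 (hZ.trans (by norm_num))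
    simp only [Set.insert_subset_iff, Set.singleton_subset_iff, Set.mem_sep_iff] at hZY
    obtain ⟨⟨ha, ha'⟩, ⟨hb, hb'⟩, ⟨hc, hc'⟩⟩ := hZY
    obtain ⟨p, hp, hpa⟩ := (not_covBy_iff (lt ha hb hab)).1 ha'
    obtain ⟨q, hq, hqb⟩ := (not_covBy_iff (lt hb ha hab.symm)).1 hb'
    obtain ⟨r, hr, hrc⟩ := (not_covBy_iff (lt hc ha hac.symm)).1 hc'
    exact hP.not_three hW (hd a ha b hb hab) (hd a ha c hc hac) (hd b hb c hc hbc)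
      hp hq hr hpa hqb hrc

end PentagonInequalities

theorem theorem4p1 (L : Type*) [Lattice L]
    (hN : InVarietyGeneratedBy N5 L)
    (S : Type*) (K : Sublattice (FreeLattice S)) (hF : Nonempty (L ≃o K))
    (Y : Set L) (hY : IsAntichain (· ≤ ·) Y) :
    (∀ d : L, (∀ a ∈ Y, ∀ b ∈ Y, a ≠ b → a ⊓ b = d) →
      Y.encard ≤ 3 ∧ {a ∈ Y | ¬ d ⋖ a}.encard ≤ 2) ∧
    (∀ d : L, (∀ a ∈ Y, ∀ b ∈ Y, a ≠ b → a ⊔ b = d) →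
      Y.encard ≤ 3 ∧ {a ∈ Y | ¬ a ⋖ d}.encard ≤ 2) := by
  obtain ⟨φ⟩ := hF
  have hW : WhitmanCondition L := (FreeLattice.whitmanCondition S).of_latticeHom
    (K.subtype.comp (φ : LatticeHom L K)) (Subtype.val_injective.comp φ.injective)
  refine ⟨fun d hd => hN.pentagonInequalities.encard_le hW hY hd, fun d hd => ?_⟩
  -- The join statement is the meet statement in the order dual.
  have h := hN.pentagonInequalities_dual.encard_le hW.dual (Y := OrderDual.ofDual ⁻¹' Y)
    (d := OrderDual.toDual d) (fun a ha b hb hab => hY hb ha (Ne.symm hab)) hd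
  have hset : {a ∈ OrderDual.ofDual ⁻¹' Y | ¬ OrderDual.toDual d ⋖ a} =
      OrderDual.ofDual ⁻¹' {a ∈ Y | ¬ a ⋖ d} := by
    ext a
    exact and_congr_right fun _ => not_congr ofDual_covBy_ofDual_iff.symm
  rw [hset] at h
  exact h
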